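/- Consider an edge network with finite sets $\mathcal I$ of services and $\mathcal M$ of servers. Service $i$ has arrival rate $\lambda_i\ge 0$ and average request size $c_i>0$; server $j$ has uplink speed, computing speed and downlink speed $r_u^j,r_s^j,r_d^j>0$. Fix the scheduling probabilities $\omega_{i,j}\in[0,1]$ (the probability that server $j$ receives the task of a request of service $i$) and a threshold $\gamma>0$. Put $$\Lambda_j=\sum_i\lambda_i\omega_{i,j},\qquad \bar c_j=\frac{\sum_i c_i\lambda_i\omega_{i,j}}{\Lambda_j},\qquad \mu_q^j=\frac{r_q^j}{\bar c_j},\qquad \phi_q^j=\mu_q^j-\Lambda_j\qquad(q\in\{u,s,d\}),$$ and assume $\Lambda_j>0$ and $\phi_u^j,\phi_s^j,\phi_d^j>0$ for every $j$. Let $\phi^j=\min(\phi_u^j,\phi_s^j,\phi_d^j)$. (If $\phi_u^j<\phi_s^j<\phi_d^j$, then $\phi^j=\phi_u^j$.) Each server $j$ is a tandem of three first-come-first-served $M/M/1$ queues (uplink, server, downlink) with Poisson external arrivals of rate $\Lambda_j$, independent exponential service times of rates $\mu_u^j,\mu_s^j,\mu_d^j$, and the departures from each queue being the arrivals at the next.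 Let $(T_u^j,T_s^j,T_d^j)$ be distributed as the response times of a request in these queues in steady state (that is, with a joint law that is preserved from one request to the next), and let $T_j=T_u^j+T_s^j+T_d^j$. Let $$\kappa=1-\prod_{j\in\mathcal M}\bigl(1-\Pr(T_j\ge\gamma)\bigr),\qquad \eta_j(x)=E\bigl[e^{xT_j}\bigr]e^{-x\gamma}.$$ Then for every $j$: $E[e^{xT_j}]<\infty$ if and only if $x<\phi^j$; a point $x\in(0,\phi^j)$ minimises $\eta_j$ on $(0,\phi^j)$ if and only if $\eta_j'(x)=0$; there is at most one such minimiser, and there is one if and only if $\gamma>1/\phi_u^j+1/\phi_s^j+1/\phi_d^j$. If every $\eta_j$, $j\in\mathcal M$, has a minimiser $x_j^\star$ in $(0,\phi^j)$, then $$\kappa\le 1-\prod_{j\in\mathcal M}\bigl(1-\eta_j(x_j^\star)\bigr),$$ and this upper bound is optimal among those obtained from Chernoff bounds: its right-hand side is the least of all the numbers $1-\prod_{j\in\mathcal M}(1-\eta_j(x_j))$ with $x_j\in[0,\phi^j)$ and $\eta_j(x_j)\le 1$ for all $j$. -/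

import Mathlib

open MeasureTheory ProbabilityTheory

noncomputable section

/-! ### FCFS single-server queues in tandem -/

/-- Response time (waiting plus service) of a request at a first-come-first-served single-server
queue: `r` is the response time of the preceding request, `a` the time between the two arrivals
at this queue, `s` the service time of the request. -/
def nextResponse (r a s : ℝ) : ℝ := max (r - a) 0 + s

/-- Time between the departures of the same two consecutive requests from that queue: the later
one arrives `a` after the earlier one and leaves after its own response time, while the
earlier one leaves after `r`. -/
def departureGap (r a s : ℝ) : ℝ := a + nextResponse r a s - r

/-- Response times `(uplink, server, downlink)` of a request in a tandem of three queues.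
`r` holds the response times of the preceding request, `a` is the time between their arrivals at
the uplink, and `s` holds the three service times of the request. Departures from one queue
are the arrivals at the next. -/
def tandemStep (r : ℝ × ℝ × ℝ) (a : ℝ) (s : ℝ × ℝ × ℝ) : ℝ × ℝ × ℝ :=
  let gapS := departureGap r.1 a s.1
  let gapD := departureGap r.2.1 gapS s.2.1
  (nextResponse r.1 a s.1, nextResponse r.2.1 gapS s.2.1, nextResponse r.2.2 gapD s.2.2)

/-- `ν` is a steady-state joint law of the three response times of a request in a tandem of three
`M/M/1` queues: external arrivals form a Poisson process of rate `arr` (independent exponential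
gaps), the service times are independent exponential variables with rates `mu₁`, `mu₂`, `mu₃`,
and `ν` is preserved when one passes from a request to the next. -/
def IsSteadyTandemLaw (arr mu₁ mu₂ mu₃ : ℝ) (ν : Measure (ℝ × ℝ × ℝ)) : Prop :=
  IsProbabilityMeasure ν ∧
    (ν.prod ((expMeasure arr).prod
        ((expMeasure mu₁).prod ((expMeasure mu₂).prod (expMeasure mu₃))))).map
      (fun p => tandemStep p.1 p.2.1 p.2.2) = ν

/-! ### The edge network -/

/-- Data of an edge network with services `I` and servers `M`, under a fixed probabilistic
scheduling `sched i j` (the probability that server `j` receives the task of a request of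
service `i`). -/
structure EdgeNetwork (I M : Type*) where
  /-- Arrival rate of requests of each service. -/
  rate : I → ℝ
  /-- Average size of a request of each service. -/
  size : I → ℝ
  /-- Uplink transmission speed of each server. -/
  upSpeed : M → ℝ
  /-- Computing capability of each server. -/
  serverSpeed : M → ℝ
  /-- Downlink transmission speed of each server. -/
  downSpeed : M → ℝ
  /-- Scheduling probabilities. -/
  sched : I → M → ℝ
  rate_nonneg : ∀ i, 0 ≤ rate i
  size_pos : ∀ i, 0 < size i
  upSpeed_pos : ∀ j, 0 < upSpeed j
  serverSpeed_pos : ∀ j, 0 < serverSpeed j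
  downSpeed_pos : ∀ j, 0 < downSpeed j
  sched_mem : ∀ i j, sched i j ∈ Set.Icc (0 : ℝ) 1

namespace EdgeNetwork

variable {I M : Type*} [Fintype I] (N : EdgeNetwork I M)

/-- Aggregated arrival rate at server `j`. -/
def aggRate (j : M) : ℝ := ∑ i, N.rate i * N.sched i j

/-- Average size of a task at server `j`. -/
def avgSize (j : M) : ℝ := (∑ i, N.size i * N.rate i * N.sched i j) / N.aggRate j

/-- Average service rate of uplink `j`. -/
def muUp (j : M) : ℝ := N.upSpeed j / N.avgSize j

/-- Average service rate of server `j`. -/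
def muServer (j : M) : ℝ := N.serverSpeed j / N.avgSize j

/-- Average service rate of downlink `j`. -/
def muDown (j : M) : ℝ := N.downSpeed j / N.avgSize j

/-- Spare capacity of uplink `j`. -/
def phiUp (j : M) : ℝ := N.muUp j - N.aggRate j

/-- Spare capacity of server `j`. -/
def phiServer (j : M) : ℝ := N.muServer j - N.aggRate j

/-- Spare capacity of downlink `j`. -/
def phiDown (j : M) : ℝ := N.muDown j - N.aggRate j

/-- The smallest of the three spare capacities. -/
def phiMin (j : M) : ℝ := min (N.phiUp j) (min (N.phiServer j) (N.phiDown j))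

/-- Every server receives requests, and all its queues are stable. -/
def IsStable : Prop :=
  ∀ j, 0 < N.aggRate j ∧ 0 < N.phiUp j ∧ 0 < N.phiServer j ∧ 0 < N.phiDown j

end EdgeNetwork

/-! ### Tail latency and Chernoff bounds -/

/-- Tail-latency probability `κ` of a family of response times. -/
def tailLatency {M Ω : Type*} [Fintype M] [MeasurableSpace Ω] (P : Measure Ω)
    (T : M → Ω → ℝ) (γ : ℝ) : ℝ :=
  1 - ∏ j, (1 - P.real {ω | γ ≤ T j ω})

/-- The Chernoff bound `η(x) = E[e^{xX}] e^{-xγ}` for the event `γ ≤ X`. -/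
def chernoff {Ω : Type*} [MeasurableSpace Ω] (P : Measure Ω) (X : Ω → ℝ) (γ x : ℝ) : ℝ :=
  (∫ ω, Real.exp (x * X ω) ∂P) * Real.exp (-(x * γ))

/-- The expression `1 - ∏ j, (1 - η_j(x_j))`. -/
def chernoffTail {M Ω : Type*} [Fintype M] [MeasurableSpace Ω] (P : Measure Ω)
    (T : M → Ω → ℝ) (γ : ℝ) (x : M → ℝ) : ℝ :=
  1 - ∏ j, (1 - chernoff P (T j) γ (x j))

end

/-! A server is a stable tandem of three queues, and everything rests on the law of the total
response time of a request: in a steady state it is a sum of three independent exponential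
variables whose rates are the spare capacities `phiUp`, `phiServer`, `phiDown`.

That the product of these exponential laws is stationary is Reich's theorem
(`measurePreserving_tandemStep`). It follows from a one-step form of Burke's theorem
(`measurePreserving_queueStep`). If `r` is the preceding response time and `a` the interarrival
time, then `r = min r a + (r - a)⁺` and `a = min r a + (a - r)⁺`, where `min r a` is independent of
`r - a` and has the law of a service time `s`. The next response time `(r - a)⁺ + s` and the
departure gap `(a - r)⁺ + s` arise by replacing `min r a` with `s`, hence have the joint law of
`r` and `a`.

That there is no other stationary law (`IsSteadyTandemLaw.eq_prod_expMeasure`) holds because a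
request that arrives late enough finds all queues empty, so that from every state the chain charges
every set which is charged by the law of the service times. By a Hahn decomposition argument, such
a chain has at most one invariant probability measure
(`eq_of_bind_eq_of_forall_absolutelyContinuous`).

The Chernoff bound `η` is therefore explicit below the smallest spare capacity, and infinite from
there on. Its logarithmic derivative `chernoffSlope` is strictly increasing, equals the mean
response time minus `γ` at `0`, and tends to infinity at the smallest spare capacity. So `η` is
minimal, over all parameters at which it is finite, exactly where the slope vanishes. As `η 0 = 1`,
the minimum does not exceed one, and the bound on the product and its optimality follow factor by
factor. -/

/-! ### Exponential variables -/

instance nullSingletonClass_expMeasure (r : ℝ) : NullSingletonClass (expMeasure r) := by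
  unfold expMeasure gammaMeasure
  infer_instance

instance sfinite_expMeasure (r : ℝ) : SFinite (expMeasure r) := by
  unfold expMeasure gammaMeasure
  infer_instance

lemma measurable_exponentialPDF (r : ℝ) : Measurable (exponentialPDF r) :=
  (measurable_exponentialPDFReal r).ennreal_ofReal

lemma lintegral_expMeasure (r : ℝ) {f : ℝ → ENNReal} (hf : Measurable f) :
    ∫⁻ x, f x ∂expMeasure r = ∫⁻ x, exponentialPDF r x * f x :=
  lintegral_withDensity_eq_lintegral_mul _ (measurable_exponentialPDF r) hf

lemma ae_nonneg_expMeasure (r : ℝ) : ∀ᵐ x ∂expMeasure r, 0 ≤ x := by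
  rw [ae_iff, show {x : ℝ | ¬ 0 ≤ x} = Set.Iio 0 by ext; simp]
  exact (withDensity_apply _ measurableSet_Iio).trans
    (lintegral_exponentialPDF_of_nonpos le_rfl)

/-- Lack of memory: beyond `a ≥ 0` an exponential law is a translate of itself, with mass
`exp (-(r * a))`. -/
lemma setLIntegral_Ici_expMeasure (r : ℝ) {a : ℝ} (ha : 0 ≤ a) {f : ℝ → ENNReal}
    (hf : Measurable f) :
    ∫⁻ x in Set.Ici a, f x ∂expMeasure r =
      ENNReal.ofReal (Real.exp (-(r * a))) * ∫⁻ u, f (a + u) ∂expMeasure r := by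
  rw [← lintegral_indicator measurableSet_Ici,
    lintegral_expMeasure r (hf.indicator measurableSet_Ici),
    lintegral_expMeasure r (by fun_prop),
    ← lintegral_const_mul _ (by have := measurable_exponentialPDF r; fun_prop),
    ← lintegral_add_left_eq_self _ a]
  refine lintegral_congr fun u => ?_
  rcases le_or_gt 0 u with hu | hu
  · rw [Set.indicator_of_mem (by simpa using hu), exponentialPDF_of_nonneg (by positivity),
      exponentialPDF_of_nonneg hu, ← mul_assoc, ← ENNReal.ofReal_mul (by positivity)]
    congr 2
    rw [show -(r * (a + u)) = -(r * a) + -(r * u) by ring, Real.exp_add]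
    ring
  · rw [Set.indicator_of_notMem (by simpa using hu), exponentialPDF_of_neg hu]
    simp

/-- Exponential tilting of an exponential law. -/
lemma lintegral_exp_mul_expMeasure {l p : ℝ} (hl : 0 < l) (hlp : 0 < l + p) {f : ℝ → ENNReal}
    (hf : Measurable f) :
    ∫⁻ a, ENNReal.ofReal (Real.exp (-(p * a))) * f a ∂expMeasure l =
      ENNReal.ofReal (l / (l + p)) * ∫⁻ a, f a ∂expMeasure (l + p) := by
  rw [lintegral_expMeasure l (by fun_prop), lintegral_expMeasure _ hf,
    ← lintegral_const_mul _ (by have := measurable_exponentialPDF (l + p); fun_prop)]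
  refine lintegral_congr fun a => ?_
  rcases le_or_gt 0 a with h | h
  · rw [exponentialPDF_of_nonneg h, exponentialPDF_of_nonneg h, ← mul_assoc, ← mul_assoc,
      ← ENNReal.ofReal_mul (by positivity), ← ENNReal.ofReal_mul (by positivity)]
    congr 2
    rw [show -((l + p) * a) = -(l * a) + -(p * a) by ring, Real.exp_add]
    field_simp
  · rw [exponentialPDF_of_neg h, exponentialPDF_of_neg h]
    simp

lemma expMeasure_Ici {r a : ℝ} (hr : 0 < r) (ha : 0 ≤ a) :
    expMeasure r (Set.Ici a) = ENNReal.ofReal (Real.exp (-(r * a))) := by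
  have := isProbabilityMeasure_expMeasure hr
  simpa using setLIntegral_Ici_expMeasure r ha (f := fun _ => 1) measurable_const

/-- The part of two competing exponential clocks where the one of rate `l` rings first: the first
ring has rate `l + p`, and the remaining time of the other clock is a fresh variable. -/
lemma lintegral_expMeasure_first {l p : ℝ} (hl : 0 < l) (hlp : 0 < l + p)
    {f : ℝ × ℝ → ENNReal} (hf : Measurable f) :
    ∫⁻ a, ∫⁻ r in Set.Ici a, f (r, a) ∂expMeasure p ∂expMeasure l =
      ENNReal.ofReal (l / (l + p)) *
        ∫⁻ s, ∫⁻ u, f (s + u, s) ∂expMeasure p ∂expMeasure (l + p) := by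
  rw [← lintegral_exp_mul_expMeasure hl hlp
    (Measurable.lintegral_prod_right' (f := fun q : ℝ × ℝ => f (q.1 + q.2, q.1)) (by fun_prop))]
  refine lintegral_congr_ae ?_
  filter_upwards [ae_nonneg_expMeasure l] with a ha
  exact setLIntegral_Ici_expMeasure p ha (by fun_prop)

/-- Two competing exponential clocks, split according to which rings first. -/
lemma lintegral_expMeasure_competing {l p : ℝ} (hl : 0 < l) (hp : 0 < p)
    {f : ℝ × ℝ → ENNReal} (hf : Measurable f) :
    ∫⁻ r, ∫⁻ a, f (r, a) ∂expMeasure l ∂expMeasure p =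
      ENNReal.ofReal (l / (l + p)) *
          ∫⁻ s, ∫⁻ u, f (s + u, s) ∂expMeasure p ∂expMeasure (l + p) +
        ENNReal.ofReal (p / (l + p)) *
          ∫⁻ s, ∫⁻ v, f (s, s + v) ∂expMeasure l ∂expMeasure (l + p) := by
  have hle : MeasurableSet {q : ℝ × ℝ | q.2 ≤ q.1} := measurableSet_le measurable_snd measurable_fst
  have h1 := lintegral_expMeasure_first hl (by linarith : 0 < l + p) hf
  have h2 := lintegral_expMeasure_first hp (by linarith : 0 < p + l)
    (f := fun q => f (q.2, q.1)) (by fun_prop)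
  rw [add_comm p l] at h2
  rw [← h1, ← h2]
  have e1 : ∫⁻ a, ∫⁻ r in Set.Ici a, f (r, a) ∂expMeasure p ∂expMeasure l =
      ∫⁻ r, ∫⁻ a in Set.Iic r, f (r, a) ∂expMeasure l ∂expMeasure p := by
    calc _ = ∫⁻ a, ∫⁻ r, {q : ℝ × ℝ | q.2 ≤ q.1}.indicator f (r, a)
          ∂expMeasure p ∂expMeasure l := by
          refine lintegral_congr fun a => ?_
          rw [← lintegral_indicator measurableSet_Ici]
          rfl
      _ = ∫⁻ r, ∫⁻ a, {q : ℝ × ℝ | q.2 ≤ q.1}.indicator f (r, a)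
          ∂expMeasure l ∂expMeasure p :=
          lintegral_lintegral_swap ((hf.indicator hle).comp measurable_swap).aemeasurable
      _ = _ := by
          refine lintegral_congr fun r => ?_
          rw [← lintegral_indicator measurableSet_Iic]
          rfl
  rw [e1, ← lintegral_add_left]
  · refine lintegral_congr fun r => ?_
    rw [setLIntegral_congr (Ioi_ae_eq_Ici (μ := expMeasure l) (a := r)).symm,
      ← Set.compl_Iic, lintegral_add_compl _ measurableSet_Iic]
  · have : (fun r => ∫⁻ a in Set.Iic r, f (r, a) ∂expMeasure l) =
        fun r => ∫⁻ a, {q : ℝ × ℝ | q.2 ≤ q.1}.indicator f (r, a) ∂expMeasure l := by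
      ext r
      rw [← lintegral_indicator measurableSet_Iic]
      rfl
    rw [this]
    exact (hf.indicator hle).lintegral_prod_right'

/-! ### Burke's theorem for one queue -/

lemma measurable_nextResponse :
    Measurable fun q : ℝ × ℝ × ℝ => nextResponse q.1 q.2.1 q.2.2 := by
  unfold nextResponse
  fun_prop

lemma measurable_departureGap :
    Measurable fun q : ℝ × ℝ × ℝ => departureGap q.1 q.2.1 q.2.2 := by
  unfold departureGap
  have := measurable_nextResponse
  fun_prop

/-- One-step form of Burke's theorem: if the response time of the preceding request has the
stationary law `Exp p`, independent of the interarrival time `Exp l` and of the service time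
`Exp (l + p)`, then the next response time and the interdeparture time are independent with laws
`Exp p` and `Exp l`. With `r = min + (r - a)⁺` and `a = min + (a - r)⁺`, the step replaces `min`
by the service time, an independent variable of the same law. -/
lemma measurePreserving_queueStep {l p : ℝ} (hl : 0 < l) (hp : 0 < p) :
    MeasurePreserving
      (fun q : ℝ × ℝ × ℝ => (nextResponse q.1 q.2.1 q.2.2, departureGap q.1 q.2.1 q.2.2))
      ((expMeasure p).prod ((expMeasure l).prod (expMeasure (l + p))))
      ((expMeasure p).prod (expMeasure l)) := by
  have hm := measurable_nextResponse.prodMk measurable_departureGap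
  have := isProbabilityMeasure_expMeasure (add_pos hl hp)
  refine ⟨hm, Measure.ext_of_lintegral _ fun g hg => ?_⟩
  rw [lintegral_map hg hm, lintegral_prod (fun q : ℝ × ℝ × ℝ =>
      g (nextResponse q.1 q.2.1 q.2.2, departureGap q.1 q.2.1 q.2.2)) (hg.comp hm).aemeasurable,
    lintegral_prod _ hg.aemeasurable]
  let f : ℝ × ℝ → ENNReal := fun q => ∫⁻ s, g (nextResponse q.1 q.2 s, departureGap q.1 q.2 s)
    ∂expMeasure (l + p)
  have hf : Measurable f := by
    refine Measurable.lintegral_prod_right'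
      (f := fun q : (ℝ × ℝ) × ℝ => g (nextResponse q.1.1 q.1.2 q.2, departureGap q.1.1 q.1.2 q.2)) ?_
    exact (hg.comp hm).comp (g := fun q : ℝ × ℝ × ℝ => _)
      (f := fun q : (ℝ × ℝ) × ℝ => (q.1.1, q.1.2, q.2)) (by fun_prop)
  have hfold : ∀ r, ∫⁻ y : ℝ × ℝ, g (nextResponse r y.1 y.2, departureGap r y.1 y.2)
      ∂(expMeasure l).prod (expMeasure (l + p)) = ∫⁻ a, f (r, a) ∂expMeasure l := by
    intro r
    refine lintegral_prod _ (Measurable.aemeasurable ?_)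
    exact (hg.comp hm).comp (measurable_prodMk_left (x := r))
  simp only [hfold]
  rw [lintegral_expMeasure_competing hl hp hf, lintegral_expMeasure_competing hl hp hg]
  congr 2
  · have : ∀ s, ∫⁻ u, f (s + u, s) ∂expMeasure p =
        ∫⁻ u, ∫⁻ t, g (t + u, t) ∂expMeasure (l + p) ∂expMeasure p := by
      intro s
      refine lintegral_congr_ae ?_
      filter_upwards [ae_nonneg_expMeasure p] with u hu
      refine lintegral_congr fun t => ?_
      simp only [departureGap, nextResponse, add_sub_cancel_left, max_eq_left hu]
      congr 2 <;> ring
    simp only [this, lintegral_const, measure_univ, mul_one]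
    exact lintegral_lintegral_swap (Measurable.aemeasurable (by fun_prop))
  · have : ∀ s, ∫⁻ v, f (s, s + v) ∂expMeasure l =
        ∫⁻ v, ∫⁻ t, g (t, t + v) ∂expMeasure (l + p) ∂expMeasure l := by
      intro s
      refine lintegral_congr_ae ?_
      filter_upwards [ae_nonneg_expMeasure l] with v hv
      refine lintegral_congr fun t => ?_
      have h0 : max (s - (s + v)) 0 = 0 := max_eq_right (by linarith)
      simp only [departureGap, nextResponse, h0]
      congr 2 <;> ring
    simp only [this, lintegral_const, measure_univ, mul_one]
    exact lintegral_lintegral_swap (Measurable.aemeasurable (by fun_prop))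

/-! ### The product law is stationary for the tandem -/

section Rearrangement

variable {α β γ δ : Type*} [MeasurableSpace α] [MeasurableSpace β] [MeasurableSpace γ]
  [MeasurableSpace δ] (μ : Measure α) (ν : Measure β) (ρ : Measure γ) (τ : Measure δ)
  [SFinite μ] [SFinite ν] [SFinite ρ] [SFinite τ]

lemma measurePreserving_prodLeftComm :
    MeasurePreserving (fun q : α × β × γ => (q.2.1, q.1, q.2.2))
      (μ.prod (ν.prod ρ)) (ν.prod (μ.prod ρ)) :=
  (measurePreserving_prodAssoc ν μ ρ).comp
    ((Measure.measurePreserving_swap.prod (MeasurePreserving.id ρ)).comp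
      ((measurePreserving_prodAssoc μ ν ρ).symm MeasurableEquiv.prodAssoc))

lemma measurePreserving_prodProdProdComm :
    MeasurePreserving (fun q : (α × β) × γ × δ => ((q.1.1, q.2.1), q.1.2, q.2.2))
      ((μ.prod ν).prod (ρ.prod τ)) ((μ.prod ρ).prod (ν.prod τ)) :=
  ((measurePreserving_prodAssoc μ ρ (ν.prod τ)).symm MeasurableEquiv.prodAssoc).comp
    (((MeasurePreserving.id μ).prod (measurePreserving_prodLeftComm ν ρ τ)).comp
      (measurePreserving_prodAssoc μ ν (ρ.prod τ)))

end Rearrangement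

/-- One queue of a tandem in equilibrium. The state `q` lists the gap between the arrivals, the
preceding response time and service time at the queue, and whatever is still needed further
downstream; the queue outputs its response time and passes the departure gap on. -/
lemma measurePreserving_queueStep_rest {β : Type*} [MeasurableSpace β] (τ : Measure β) [SFinite τ]
    {l p : ℝ} (hl : 0 < l) (hp : 0 < p) :
    MeasurePreserving
      (fun q : ℝ × (ℝ × ℝ) × β =>
        (nextResponse q.2.1.1 q.1 q.2.1.2, departureGap q.2.1.1 q.1 q.2.1.2, q.2.2))
      ((expMeasure l).prod (((expMeasure p).prod (expMeasure (l + p))).prod τ))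
      ((expMeasure p).prod ((expMeasure l).prod τ)) :=
  (measurePreserving_prodAssoc (expMeasure p) (expMeasure l) τ).comp
    (((measurePreserving_queueStep hl hp).prod (MeasurePreserving.id τ)).comp
      (((measurePreserving_prodLeftComm (expMeasure l) (expMeasure p) (expMeasure (l + p))).prod
        (MeasurePreserving.id τ)).comp
        ((measurePreserving_prodAssoc (expMeasure l)
          ((expMeasure p).prod (expMeasure (l + p))) τ).symm MeasurableEquiv.prodAssoc)))

/-- Reich's theorem: independent exponential response times whose rates are the spare capacities
form a steady-state law of the tandem. By Burke's theorem each queue passes a Poisson stream on,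
independent of its own response time. -/
lemma measurePreserving_tandemStep {l p₁ p₂ p₃ : ℝ} (hl : 0 < l) (h₁ : 0 < p₁) (h₂ : 0 < p₂)
    (h₃ : 0 < p₃) :
    MeasurePreserving
      (fun p : (ℝ × ℝ × ℝ) × ℝ × ℝ × ℝ × ℝ => tandemStep p.1 p.2.1 p.2.2)
      (((expMeasure p₁).prod ((expMeasure p₂).prod (expMeasure p₃))).prod ((expMeasure l).prod
        ((expMeasure (l + p₁)).prod ((expMeasure (l + p₂)).prod (expMeasure (l + p₃))))))
      ((expMeasure p₁).prod ((expMeasure p₂).prod (expMeasure p₃))) := by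
  have := isProbabilityMeasure_expMeasure hl
  have last := measurePreserving_fst.comp ((measurePreserving_queueStep hl h₃).comp
    (measurePreserving_prodLeftComm (expMeasure l) (expMeasure p₃) (expMeasure (l + p₃))))
  have two := ((MeasurePreserving.id (expMeasure p₂)).prod last).comp
    (measurePreserving_queueStep_rest ((expMeasure p₃).prod (expMeasure (l + p₃))) hl h₂)
  have three := ((MeasurePreserving.id (expMeasure p₁)).prod two).comp
    (measurePreserving_queueStep_rest (((expMeasure p₂).prod (expMeasure (l + p₂))).prod
      ((expMeasure p₃).prod (expMeasure (l + p₃)))) hl h₁)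
  -- regroup the preceding response times and the service times queue by queue
  have pair := ((MeasurePreserving.id ((expMeasure p₁).prod (expMeasure (l + p₁)))).prod
      (measurePreserving_prodProdProdComm (expMeasure p₂) (expMeasure p₃)
        (expMeasure (l + p₂)) (expMeasure (l + p₃)))).comp
    (measurePreserving_prodProdProdComm (expMeasure p₁) ((expMeasure p₂).prod (expMeasure p₃))
      (expMeasure (l + p₁)) ((expMeasure (l + p₂)).prod (expMeasure (l + p₃))))
  exact three.comp (((MeasurePreserving.id (expMeasure l)).prod pair).comp
    (measurePreserving_prodLeftComm ((expMeasure p₁).prod ((expMeasure p₂).prod (expMeasure p₃)))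
      (expMeasure l) _))

/-! ### Uniqueness of the steady-state law -/

/-- A Markov kernel whose transition laws all dominate one nonzero measure `m` has at most one
invariant probability measure. The parts `α` and `β` by which two of them exceed each other sit on
complementary sets, and invariance forces the kernel to keep them there; but from any point the
kernel charges whichever of the two sets is charged by `m`. -/
lemma eq_of_bind_eq_of_forall_absolutelyContinuous {E : Type*} [MeasurableSpace E]
    {κ : Kernel E E} [IsMarkovKernel κ] {m μ ν : Measure E} (hm : m ≠ 0)
    (hκ : ∀ x, m ≪ κ x) [IsProbabilityMeasure μ] [IsProbabilityMeasure ν]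
    (hμ : μ.bind κ = μ) (hν : ν.bind κ = ν) : μ = ν := by
  obtain ⟨A, hA⟩ := exists_isHahnDecomposition ν μ
  have hAm := hA.measurableSet
  set α := μ.restrict A - ν.restrict A
  set β := ν.restrict Aᶜ - μ.restrict Aᶜ
  have eα : α + ν.restrict A = μ.restrict A := Measure.sub_add_cancel_of_le hA.le_on
  have eβ : β + μ.restrict Aᶜ = ν.restrict Aᶜ := Measure.sub_add_cancel_of_le hA.ge_on_compl
  have hαA : α Aᶜ = 0 := by
    have h := congrArg (fun t : Measure E => t Aᶜ) eα
    simpa [Measure.restrict_apply hAm.compl] using h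
  have hβA : β A = 0 := by
    have h := congrArg (fun t : Measure E => t A) eβ
    simpa [Measure.restrict_apply hAm] using h
  have key : μ + β = ν + α := by
    calc μ + β = (μ.restrict A + μ.restrict Aᶜ) + β := by rw [Measure.restrict_add_restrict_compl hAm]
      _ = (α + ν.restrict A) + (β + μ.restrict Aᶜ) := by rw [eα]; abel
      _ = (ν.restrict A + ν.restrict Aᶜ) + α := by rw [eβ]; abel
      _ = ν + α := by rw [Measure.restrict_add_restrict_compl hAm]
  have hbind : ∀ (t : Measure E) {s : Set E}, MeasurableSet s → t.bind κ s = ∫⁻ x, κ x s ∂t :=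
    fun t s hs => Measure.bind_apply hs κ.aemeasurable
  have hmass : α Set.univ = β Set.univ := by
    have h := congrArg (fun t : Measure E => t Set.univ) key
    simpa using h.symm
  -- neither excess leaves its own set
  have hflow : ∫⁻ x, κ x A ∂β + ∫⁻ x, κ x Aᶜ ∂α = 0 := by
    have hbA : ∫⁻ x, κ x A ∂μ + ∫⁻ x, κ x A ∂β = ∫⁻ x, κ x A ∂ν + ∫⁻ x, κ x A ∂α := by
      rw [← lintegral_add_measure, ← lintegral_add_measure, key]
    rw [← hbind μ hAm, ← hbind ν hAm, hμ, hν] at hbA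
    have hkA : μ A = ν A + α A := by
      have h := congrArg (fun t : Measure E => t A) key
      simpa [hβA] using h
    have htot : ∫⁻ x, κ x A ∂α + ∫⁻ x, κ x Aᶜ ∂α = α A := by
      rw [← lintegral_add_left (κ.measurable_coe hAm)]
      simp only [measure_add_measure_compl hAm, measure_univ, lintegral_one]
      rw [← measure_add_measure_compl hAm, hαA, add_zero]
    have h1 : ν A + (∫⁻ x, κ x A ∂α + (∫⁻ x, κ x A ∂β + ∫⁻ x, κ x Aᶜ ∂α)) =
        ν A + (∫⁻ x, κ x A ∂α + 0) := by
      rw [add_zero, ← hbA, hkA, ← htot]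
      ring
    have h2 := (ENNReal.add_right_inj (measure_ne_top ν A)).1 h1
    refine (ENNReal.add_right_inj (ne_top_of_le_ne_top (measure_ne_top α A) ?_)).1 h2
    exact htot ▸ le_self_add
  rw [add_eq_zero] at hflow
  have hpos : ∀ {s : Set E} (t : Measure E), MeasurableSet s → m s ≠ 0 →
      ∫⁻ x, κ x s ∂t = 0 → t = 0 := by
    intro s t hs hms h
    rw [lintegral_eq_zero_iff (κ.measurable_coe hs)] at h
    have : ∀ᵐ _ ∂t, False := h.mono fun x hx => hms (hκ x hx)
    simpa using this
  have hzero : α = 0 ∧ β = 0 := by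
    by_cases hmA : m A = 0
    · have hmc : m Aᶜ ≠ 0 := fun h => hm (by
        rw [← Measure.measure_univ_eq_zero, ← measure_add_measure_compl hAm, hmA, h, add_zero])
      have h := hpos α hAm.compl hmc hflow.2
      exact ⟨h, by rw [← Measure.measure_univ_eq_zero, ← hmass, h]; simp⟩
    · have h := hpos β hAm hmA hflow.1
      exact ⟨by rw [← Measure.measure_univ_eq_zero, hmass, h]; simp, h⟩
  simpa [hzero.1, hzero.2] using key

/-- The form of the uniqueness criterion for a chain driven by independent noise of law `ρ`. -/
lemma eq_of_map_prod_eq {E F : Type*} [MeasurableSpace E] [MeasurableSpace F]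
    {f : E × F → E} (hf : Measurable f) {ρ : Measure F} [IsProbabilityMeasure ρ]
    {m μ ν : Measure E} (hm : m ≠ 0) (hρ : ∀ x, m ≪ ρ.map fun y => f (x, y))
    [IsProbabilityMeasure μ] [IsProbabilityMeasure ν]
    (hμ : (μ.prod ρ).map f = μ) (hν : (ν.prod ρ).map f = ν) : μ = ν := by
  let κ : Kernel E E := (Kernel.id ×ₖ Kernel.const E ρ).map f
  have : IsMarkovKernel κ := Kernel.IsMarkovKernel.map _ hf
  have hκ : ∀ x, κ x = ρ.map fun y => f (x, y) := by
    intro x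
    rw [Kernel.map_apply _ hf, Kernel.prod_apply, Kernel.id_apply, Kernel.const_apply,
      Measure.dirac_prod, Measure.map_map hf measurable_prodMk_left]
    rfl
  have hbind : ∀ t : Measure E, IsProbabilityMeasure t → t.bind κ = (t.prod ρ).map f := by
    intro t _
    ext s hs
    rw [Measure.bind_apply hs κ.aemeasurable, Measure.map_apply hf hs, Measure.prod_apply (hf hs)]
    refine lintegral_congr fun x => ?_
    rw [hκ, Measure.map_apply (by fun_prop) hs]
    rfl
  exact eq_of_bind_eq_of_forall_absolutelyContinuous (κ := κ) hm (fun x => by rw [hκ]; exact hρ x)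
    (by rw [hbind μ inferInstance, hμ]) (by rw [hbind ν inferInstance, hν])

lemma measurable_tandemStep :
    Measurable fun p : (ℝ × ℝ × ℝ) × ℝ × ℝ × ℝ × ℝ => tandemStep p.1 p.2.1 p.2.2 := by
  simp only [tandemStep, departureGap, nextResponse]
  fun_prop

/-- A request that arrives late enough finds all queues empty. -/
lemma tandemStep_eq_of_le {r s : ℝ × ℝ × ℝ} {a : ℝ} (ha : |r.1| + |r.2.1| + |r.2.2| ≤ a)
    (hs₁ : 0 ≤ s.1) (hs₂ : 0 ≤ s.2.1) : tandemStep r a s = s := by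
  obtain ⟨r₁, r₂, r₃⟩ := r
  obtain ⟨s₁, s₂, s₃⟩ := s
  dsimp only at ha hs₁ hs₂
  have := le_abs_self r₁
  have := le_abs_self r₂
  have := le_abs_self r₃
  have := abs_nonneg r₁
  have := abs_nonneg r₂
  have := abs_nonneg r₃
  have h₁ : max (r₁ - a) 0 = 0 := max_eq_right (by linarith)
  have h₂ : max (r₂ - (a + s₁ - r₁)) 0 = 0 := max_eq_right (by linarith)
  have h₃ : max (r₃ - (a + s₁ - r₁ + s₂ - r₂)) 0 = 0 := max_eq_right (by linarith)
  simp [tandemStep, departureGap, nextResponse, h₁, h₂, h₃]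

/-- The steady-state law of a stable tandem is unique: the response times of a request are
independent and exponential, the rates being the spare capacities. -/
lemma IsSteadyTandemLaw.eq_prod_expMeasure {l p₁ p₂ p₃ : ℝ} (hl : 0 < l) (h₁ : 0 < p₁)
    (h₂ : 0 < p₂) (h₃ : 0 < p₃) {ν : Measure (ℝ × ℝ × ℝ)}
    (hν : IsSteadyTandemLaw l (l + p₁) (l + p₂) (l + p₃) ν) :
    ν = (expMeasure p₁).prod ((expMeasure p₂).prod (expMeasure p₃)) := by
  have := hν.1
  have := isProbabilityMeasure_expMeasure hl
  have := isProbabilityMeasure_expMeasure h₁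
  have := isProbabilityMeasure_expMeasure h₂
  have := isProbabilityMeasure_expMeasure h₃
  have := isProbabilityMeasure_expMeasure (add_pos hl h₁)
  have := isProbabilityMeasure_expMeasure (add_pos hl h₂)
  have := isProbabilityMeasure_expMeasure (add_pos hl h₃)
  set m := (expMeasure (l + p₁)).prod ((expMeasure (l + p₂)).prod (expMeasure (l + p₃)))
  refine eq_of_map_prod_eq (f := fun p => tandemStep p.1 p.2.1 p.2.2)
    (ρ := (expMeasure l).prod m) (m := m) measurable_tandemStep (IsProbabilityMeasure.ne_zero m)
    (fun r => Measure.AbsolutelyContinuous.mk fun B hB h0 => ?_) hν.2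
    (measurePreserving_tandemStep hl h₁ h₂ h₃).map_eq
  have hr : Measurable fun y : ℝ × ℝ × ℝ × ℝ => tandemStep r y.1 y.2 :=
    measurable_tandemStep.comp (measurable_prodMk_left (x := r))
  replace h0 : ((expMeasure l).prod m) ((fun y => tandemStep r y.1 y.2) ⁻¹' B) = 0 := by
    rwa [← Measure.map_apply hr hB]
  have hS : ∀ᵐ s ∂m, 0 ≤ s.1 ∧ 0 ≤ s.2.1 :=
    (Measure.quasiMeasurePreserving_fst.ae (ae_nonneg_expMeasure _)).and
      (Measure.quasiMeasurePreserving_snd.ae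
        (Measure.quasiMeasurePreserving_fst.ae (ae_nonneg_expMeasure _)))
  have hsub : Set.Ici (|r.1| + |r.2.1| + |r.2.2|) ×ˢ (B ∩ {s | 0 ≤ s.1 ∧ 0 ≤ s.2.1}) ⊆
      (fun y : ℝ × ℝ × ℝ × ℝ => tandemStep r y.1 y.2) ⁻¹' B := by
    rintro ⟨a, s⟩ ⟨ha, hsB, hs₁, hs₂⟩
    change tandemStep r a s ∈ B
    rwa [tandemStep_eq_of_le ha hs₁ hs₂]
  have hz := measure_mono_null hsub h0
  rw [Measure.prod_prod, expMeasure_Ici hl (by positivity), mul_eq_zero] at hz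
  have hz' := hz.resolve_left (by simpa using Real.exp_pos _)
  exact (measure_inter_conull (μ := m) (s := B) (t := {s | 0 ≤ s.1 ∧ 0 ≤ s.2.1})
    (ae_iff.1 hS)).symm.trans hz'

/-! ### Exponential moments of the total response time -/

lemma lintegral_exp_expMeasure_of_lt {p x : ℝ} (hp : 0 < p) (hx : x < p) :
    ∫⁻ t, ENNReal.ofReal (Real.exp (x * t)) ∂expMeasure p = ENNReal.ofReal (p / (p - x)) := by
  have hpx : 0 < p + -x := by linarith
  have := isProbabilityMeasure_expMeasure hpx
  simpa [← sub_eq_add_neg, measure_univ] using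
    lintegral_exp_mul_expMeasure hp hpx (f := fun _ => 1) measurable_const

lemma lintegral_exp_expMeasure_of_le {p x : ℝ} (hp : 0 < p) (hx : p ≤ x) :
    ∫⁻ t, ENNReal.ofReal (Real.exp (x * t)) ∂expMeasure p = ⊤ := by
  rw [lintegral_expMeasure p (by fun_prop), eq_top_iff]
  calc (⊤ : ENNReal) = ∫⁻ _ in Set.Ici (0 : ℝ), ENNReal.ofReal p := by
        rw [setLIntegral_const, Real.volume_Ici, ENNReal.mul_top (by simpa using hp)]
    _ ≤ ∫⁻ t in Set.Ici (0 : ℝ), exponentialPDF p t * ENNReal.ofReal (Real.exp (x * t)) := by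
        refine setLIntegral_mono (by have := measurable_exponentialPDF p; fun_prop) fun t ht => ?_
        have ht : 0 ≤ t := ht
        rw [exponentialPDF_of_nonneg ht, ← ENNReal.ofReal_mul (by positivity), mul_assoc,
          ← Real.exp_add]
        refine ENNReal.ofReal_le_ofReal (le_mul_of_one_le_right hp.le (Real.one_le_exp ?_))
        nlinarith
    _ ≤ _ := setLIntegral_le_lintegral _ _

lemma lintegral_exp_expMeasure_ne_zero {p : ℝ} (hp : 0 < p) (x : ℝ) :
    ∫⁻ t, ENNReal.ofReal (Real.exp (x * t)) ∂expMeasure p ≠ 0 := by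
  rcases lt_or_ge x p with h | h
  · rw [lintegral_exp_expMeasure_of_lt hp h]
    have : 0 < p / (p - x) := div_pos hp (by linarith)
    simpa using this
  · simp [lintegral_exp_expMeasure_of_le hp h]

section TotalResponse

variable {Ω : Type*} [MeasurableSpace Ω] {P : Measure Ω} {U S D : Ω → ℝ} {a b c : ℝ}

lemma lintegral_exp_add_add (hU : AEMeasurable U P) (hS : AEMeasurable S P)
    (hD : AEMeasurable D P)
    (hlaw : P.map (fun ω => (U ω, S ω, D ω)) =
      (expMeasure a).prod ((expMeasure b).prod (expMeasure c))) (x : ℝ) :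
    ∫⁻ ω, ENNReal.ofReal (Real.exp (x * (U ω + S ω + D ω))) ∂P =
      (∫⁻ t, ENNReal.ofReal (Real.exp (x * t)) ∂expMeasure a) *
        ((∫⁻ t, ENNReal.ofReal (Real.exp (x * t)) ∂expMeasure b) *
          ∫⁻ t, ENNReal.ofReal (Real.exp (x * t)) ∂expMeasure c) := by
  rw [← lintegral_prod_mul (by fun_prop) (by fun_prop),
    ← lintegral_prod_mul (g := fun q : ℝ × ℝ => ENNReal.ofReal (Real.exp (x * q.1)) *
      ENNReal.ofReal (Real.exp (x * q.2))) (by fun_prop) (by fun_prop), ← hlaw,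
    lintegral_map' (by fun_prop) (by fun_prop)]
  refine lintegral_congr fun ω => ?_
  rw [← ENNReal.ofReal_mul (Real.exp_pos _).le, ← Real.exp_add,
    ← ENNReal.ofReal_mul (Real.exp_pos _).le, ← Real.exp_add]
  congr 2
  ring

lemma integrable_exp_add_add_iff (hU : AEMeasurable U P) (hS : AEMeasurable S P)
    (hD : AEMeasurable D P) (ha : 0 < a) (hb : 0 < b) (hc : 0 < c)
    (hlaw : P.map (fun ω => (U ω, S ω, D ω)) =
      (expMeasure a).prod ((expMeasure b).prod (expMeasure c))) (x : ℝ) :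
    Integrable (fun ω => Real.exp (x * (U ω + S ω + D ω))) P ↔ x < min a (min b c) := by
  have hm : AEStronglyMeasurable (fun ω => Real.exp (x * (U ω + S ω + D ω))) P :=
    AEMeasurable.aestronglyMeasurable (by fun_prop)
  rw [← lintegral_ofReal_ne_top_iff_integrable hm (ae_of_all _ fun _ => (Real.exp_pos _).le),
    lintegral_exp_add_add hU hS hD hlaw, lt_min_iff, lt_min_iff]
  have h0a := lintegral_exp_expMeasure_ne_zero ha x
  have h0b := lintegral_exp_expMeasure_ne_zero hb x
  have h0c := lintegral_exp_expMeasure_ne_zero hc x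
  constructor
  · intro h
    refine ⟨?_, ?_, ?_⟩ <;> by_contra! hle <;> refine h ?_
    · rw [lintegral_exp_expMeasure_of_le ha hle, ENNReal.top_mul (mul_ne_zero h0b h0c)]
    · rw [lintegral_exp_expMeasure_of_le hb hle, ENNReal.top_mul h0c, ENNReal.mul_top h0a]
    · rw [lintegral_exp_expMeasure_of_le hc hle, ENNReal.mul_top h0b, ENNReal.mul_top h0a]
  · rintro ⟨h1, h2, h3⟩
    rw [lintegral_exp_expMeasure_of_lt ha h1, lintegral_exp_expMeasure_of_lt hb h2,
      lintegral_exp_expMeasure_of_lt hc h3]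
    exact ENNReal.mul_ne_top ENNReal.ofReal_ne_top
      (ENNReal.mul_ne_top ENNReal.ofReal_ne_top ENNReal.ofReal_ne_top)

lemma chernoff_add_add_eq (hU : AEMeasurable U P) (hS : AEMeasurable S P)
    (hD : AEMeasurable D P) (ha : 0 < a) (hb : 0 < b) (hc : 0 < c)
    (hlaw : P.map (fun ω => (U ω, S ω, D ω)) =
      (expMeasure a).prod ((expMeasure b).prod (expMeasure c))) (γ : ℝ) {x : ℝ}
    (hx : x < min a (min b c)) :
    chernoff P (fun ω => U ω + S ω + D ω) γ x =
      a / (a - x) * (b / (b - x) * (c / (c - x))) * Real.exp (-(x * γ)) := by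
  rw [lt_min_iff, lt_min_iff] at hx
  obtain ⟨hxa, hxb, hxc⟩ := hx
  have h1 : 0 < a / (a - x) := div_pos ha (by linarith)
  have h2 : 0 < b / (b - x) := div_pos hb (by linarith)
  have h3 : 0 < c / (c - x) := div_pos hc (by linarith)
  rw [chernoff, integral_eq_lintegral_of_nonneg_ae (ae_of_all _ fun _ => (Real.exp_pos _).le)
    (AEMeasurable.aestronglyMeasurable (by fun_prop)), lintegral_exp_add_add hU hS hD hlaw,
    lintegral_exp_expMeasure_of_lt ha hxa, lintegral_exp_expMeasure_of_lt hb hxb,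
    lintegral_exp_expMeasure_of_lt hc hxc, ENNReal.toReal_mul, ENNReal.toReal_mul,
    ENNReal.toReal_ofReal h1.le, ENNReal.toReal_ofReal h2.le, ENNReal.toReal_ofReal h3.le]

/-! ### Minimising the Chernoff bound -/

/-- The logarithmic derivative of the Chernoff bound for a sum of independent exponential
variables of rates `a`, `b`, `c`. -/
noncomputable def chernoffSlope (a b c γ x : ℝ) : ℝ := 1 / (a - x) + 1 / (b - x) + 1 / (c - x) - γ

lemma hasDerivAt_chernoff (hU : AEMeasurable U P) (hS : AEMeasurable S P)
    (hD : AEMeasurable D P) (ha : 0 < a) (hb : 0 < b) (hc : 0 < c)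
    (hlaw : P.map (fun ω => (U ω, S ω, D ω)) =
      (expMeasure a).prod ((expMeasure b).prod (expMeasure c))) (γ : ℝ) {x : ℝ}
    (hx : x < min a (min b c)) :
    HasDerivAt (chernoff P (fun ω => U ω + S ω + D ω) γ)
      (chernoff P (fun ω => U ω + S ω + D ω) γ x * chernoffSlope a b c γ x) x := by
  have heq : chernoff P (fun ω => U ω + S ω + D ω) γ =ᶠ[nhds x]
      fun x => a / (a - x) * (b / (b - x) * (c / (c - x))) * Real.exp (-(x * γ)) := by
    filter_upwards [Iio_mem_nhds hx] with y hy
    exact chernoff_add_add_eq hU hS hD ha hb hc hlaw γ hy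
  rw [heq.hasDerivAt_iff, chernoff_add_add_eq hU hS hD ha hb hc hlaw γ hx]
  rw [lt_min_iff, lt_min_iff] at hx
  have h : ∀ p : ℝ, x < p → HasDerivAt (fun x => p / (p - x)) (p / (p - x) * (1 / (p - x))) x := by
    intro p hp
    have hne : p - x ≠ 0 := by linarith
    refine ((hasDerivAt_const x p).fun_div ((hasDerivAt_id' x).const_sub p) hne).congr_deriv ?_
    field_simp
    ring
  have he : HasDerivAt (fun x => Real.exp (-(x * γ))) (Real.exp (-(x * γ)) * -(1 * γ)) x :=
    ((hasDerivAt_id' x).mul_const γ).neg.exp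
  refine (((h a hx.1).fun_mul ((h b hx.2.1).fun_mul (h c hx.2.2))).fun_mul he).congr_deriv ?_
  simp only [chernoffSlope]
  ring

end TotalResponse

lemma strictMonoOn_chernoffSlope (a b c γ : ℝ) :
    StrictMonoOn (chernoffSlope a b c γ) (Set.Iio (min a (min b c))) := by
  intro x hx y hy hxy
  simp only [Set.mem_Iio, lt_min_iff] at hx hy
  have h : ∀ p, y < p → 1 / (p - x) < 1 / (p - y) := fun p hp =>
    one_div_lt_one_div_of_lt (by linarith) (by linarith)
  have := h a hy.1
  have := h b hy.2.1
  have := h c hy.2.2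
  simp only [chernoffSlope]
  linarith

/-- The slope tends to infinity at the smallest rate, so it has a zero on the positive axis as
soon as it starts out negative. -/
lemma exists_chernoffSlope_eq_zero {a b c γ : ℝ} (ha : 0 < a) (hb : 0 < b) (hc : 0 < c)
    (hγ : 1 / a + 1 / b + 1 / c < γ) :
    ∃ x ∈ Set.Ioo 0 (min a (min b c)), chernoffSlope a b c γ x = 0 := by
  set m := min a (min b c) with hm
  have hm0 : 0 < m := lt_min ha (lt_min hb hc)
  have hγ0 : 0 < γ := lt_trans (by positivity) hγ
  -- at distance `m / (1 + m * γ)` from the pole, the singular term alone is `1 / m + γ`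
  set δ := m / (1 + m * γ) with hδ
  have hδ0 : 0 < δ := by positivity
  have hδm : δ < m := div_lt_self hm0 (by nlinarith [mul_pos hm0 hγ0])
  have hδi : γ < 1 / δ := by
    rw [hδ, one_div_div, lt_div_iff₀ hm0]
    linarith
  have hlt : m - δ < m := by linarith
  have hpos : 0 < chernoffSlope a b c γ (m - δ) := by
    have hlt' := hlt
    nth_rewrite 2 [hm] at hlt'
    rw [lt_min_iff, lt_min_iff] at hlt'
    have h1 : 0 < 1 / (a - (m - δ)) := one_div_pos.2 (by linarith [hlt'.1])
    have h2 : 0 < 1 / (b - (m - δ)) := one_div_pos.2 (by linarith [hlt'.2.1])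
    have h3 : 0 < 1 / (c - (m - δ)) := one_div_pos.2 (by linarith [hlt'.2.2])
    have hcase : m = a ∨ m = b ∨ m = c := by
      rcases min_choice a (min b c) with h | h
      · exact Or.inl h
      · rcases min_choice b c with h' | h'
        · exact Or.inr (Or.inl (h.trans h'))
        · exact Or.inr (Or.inr (h.trans h'))
    have hδ' : ∀ p, m = p → 1 / (p - (m - δ)) = 1 / δ := by
      rintro p rfl
      rw [sub_sub_cancel]
    simp only [chernoffSlope]
    rcases hcase with h | h | h
    · rw [hδ' a h]; linarith
    · rw [hδ' b h]; linarith
    · rw [hδ' c h]; linarith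
  have hneg : chernoffSlope a b c γ 0 < 0 := by
    simp only [chernoffSlope, sub_zero]
    linarith
  have hcont : ContinuousOn (chernoffSlope a b c γ) (Set.Icc 0 (m - δ)) := by
    have : ∀ x ∈ Set.Icc 0 (m - δ), a - x ≠ 0 ∧ b - x ≠ 0 ∧ c - x ≠ 0 := by
      intro x hx
      have hx' : x < m := hx.2.trans_lt hlt
      rw [hm, lt_min_iff, lt_min_iff] at hx'
      exact ⟨by linarith [hx'.1], by linarith [hx'.2.1], by linarith [hx'.2.2]⟩
    unfold chernoffSlope
    refine ContinuousOn.sub (ContinuousOn.add (ContinuousOn.add ?_ ?_) ?_) continuousOn_const <;>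
      refine ContinuousOn.div continuousOn_const (by fun_prop) fun x hx => ?_
    exacts [(this x hx).1, (this x hx).2.1, (this x hx).2.2]
  obtain ⟨x, hx, hx0⟩ := intermediate_value_Ioo (by linarith : (0 : ℝ) ≤ m - δ) hcont ⟨hneg, hpos⟩
  exact ⟨x, ⟨hx.1, hx.2.trans hlt⟩, hx0⟩

/-- A positive function with increasing logarithmic derivative `g` on a half-line is minimal
where `g` vanishes. -/
lemma isMinOn_Iio_of_log_deriv_eq_zero {η g : ℝ → ℝ} {m x : ℝ} (hx : x < m)
    (hη : ∀ y < m, HasDerivAt η (η y * g y) y) (hpos : ∀ y < m, 0 < η y)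
    (hg : StrictMonoOn g (Set.Iio m)) (h0 : g x = 0) : IsMinOn η (Set.Iio m) x := by
  intro y hy
  have hy : y < m := hy
  change η x ≤ η y
  rcases le_total y x with hyx | hxy
  · refine antitoneOn_of_deriv_nonpos (convex_Icc y x) (fun z hz => ?_) (fun z hz => ?_)
      (fun z hz => ?_) (Set.left_mem_Icc.2 hyx) (Set.right_mem_Icc.2 hyx) hyx
    · exact (hη z (hz.2.trans_lt hx)).continuousAt.continuousWithinAt
    · rw [interior_Icc] at hz
      exact (hη z (hz.2.trans hx)).differentiableAt.differentiableWithinAt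
    · rw [interior_Icc] at hz
      rw [(hη z (hz.2.trans hx)).deriv]
      exact mul_nonpos_of_nonneg_of_nonpos (hpos z (hz.2.trans hx)).le
        (h0 ▸ (hg (hz.2.trans hx) hx hz.2).le)
  · refine monotoneOn_of_deriv_nonneg (convex_Icc x y) (fun z hz => ?_) (fun z hz => ?_)
      (fun z hz => ?_) (Set.left_mem_Icc.2 hxy) (Set.right_mem_Icc.2 hxy) hxy
    · exact (hη z (hz.2.trans_lt hy)).continuousAt.continuousWithinAt
    · rw [interior_Icc] at hz
      exact (hη z (hz.2.trans hy)).differentiableAt.differentiableWithinAt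
    · rw [interior_Icc] at hz
      rw [(hη z (hz.2.trans hy)).deriv]
      exact mul_nonneg (hpos z (hz.2.trans hy)).le (h0 ▸ (hg hx (hz.2.trans hy) hz.1).le)

lemma measureReal_ge_le_chernoff {Ω : Type*} [MeasurableSpace Ω] {P : Measure Ω}
    [IsFiniteMeasure P] {X : Ω → ℝ} {γ x : ℝ} (hx : 0 ≤ x)
    (h : Integrable (fun ω => Real.exp (x * X ω)) P) :
    P.real {ω | γ ≤ X ω} ≤ chernoff P X γ x := by
  refine (measure_ge_le_exp_mul_mgf γ hx h).trans_eq ?_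
  rw [chernoff, mgf, mul_comm, neg_mul]

/-! ### Tail latency of the network -/

theorem theorem1 {I M Ω : Type*} [Fintype I] [Fintype M] [MeasurableSpace Ω]
    (P : Measure Ω) [IsProbabilityMeasure P]
    (N : EdgeNetwork I M) (hN : N.IsStable)
    (Tu Ts Td T : M → Ω → ℝ)
    (hTu : ∀ j, AEMeasurable (Tu j) P) (hTs : ∀ j, AEMeasurable (Ts j) P)
    (hTd : ∀ j, AEMeasurable (Td j) P)
    (hlaw : ∀ j, IsSteadyTandemLaw (N.aggRate j) (N.muUp j) (N.muServer j) (N.muDown j)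
      (P.map (fun ω => (Tu j ω, Ts j ω, Td j ω))))
    (hT : ∀ j ω, T j ω = Tu j ω + Ts j ω + Td j ω)
    (γ : ℝ) (hγ : 0 < γ) :
    -- the Chernoff bound of server `j` is finite exactly for parameters below `phiMin j`
    (∀ j x, Integrable (fun ω => Real.exp (x * T j ω)) P ↔ x < N.phiMin j) ∧
    -- on `(0, phiMin j)` the minimisers are the critical points, and there is at most one
    (∀ j, ∀ x ∈ Set.Ioo 0 (N.phiMin j),
      (IsMinOn (chernoff P (T j) γ) (Set.Ioo 0 (N.phiMin j)) x ↔
        HasDerivAt (chernoff P (T j) γ) 0 x)) ∧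
    (∀ j, {x ∈ Set.Ioo 0 (N.phiMin j) |
      IsMinOn (chernoff P (T j) γ) (Set.Ioo 0 (N.phiMin j)) x}.Subsingleton) ∧
    -- a minimiser exists exactly when `γ` exceeds the mean response time
    (∀ j, (∃ x ∈ Set.Ioo 0 (N.phiMin j),
        IsMinOn (chernoff P (T j) γ) (Set.Ioo 0 (N.phiMin j)) x) ↔
      1 / N.phiUp j + 1 / N.phiServer j + 1 / N.phiDown j < γ) ∧
    -- the minimisers give an upper bound on the tail-latency probability, and it is the least
    -- of all those obtained from Chernoff bounds that do not exceed one
    (∀ xs : M → ℝ,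
      (∀ j, xs j ∈ Set.Ioo 0 (N.phiMin j) ∧
        IsMinOn (chernoff P (T j) γ) (Set.Ioo 0 (N.phiMin j)) (xs j)) →
      tailLatency P T γ ≤ chernoffTail P T γ xs ∧
      IsLeast {b : ℝ | ∃ x : M → ℝ,
          (∀ j, x j ∈ Set.Ico 0 (N.phiMin j) ∧ chernoff P (T j) γ (x j) ≤ 1) ∧
          b = chernoffTail P T γ x}
        (chernoffTail P T γ xs)) := by
  obtain rfl : T = fun j ω => Tu j ω + Ts j ω + Td j ω := by
    ext j ω
    exact hT j ω
  have hprod : ∀ j, P.map (fun ω => (Tu j ω, Ts j ω, Td j ω)) =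
      (expMeasure (N.phiUp j)).prod
        ((expMeasure (N.phiServer j)).prod (expMeasure (N.phiDown j))) := by
    intro j
    obtain ⟨hl, h₁, h₂, h₃⟩ := hN j
    refine IsSteadyTandemLaw.eq_prod_expMeasure hl h₁ h₂ h₃ ?_
    simpa only [EdgeNetwork.phiUp, EdgeNetwork.phiServer, EdgeNetwork.phiDown,
      add_sub_cancel] using hlaw j
  have hint : ∀ j x, Integrable (fun ω => Real.exp (x * (Tu j ω + Ts j ω + Td j ω))) P ↔
      x < N.phiMin j := fun j x =>
    integrable_exp_add_add_iff (hTu j) (hTs j) (hTd j) (hN j).2.1 (hN j).2.2.1 (hN j).2.2.2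
      (hprod j) x
  set η : M → ℝ → ℝ := fun j => chernoff P (fun ω => Tu j ω + Ts j ω + Td j ω) γ with hη
  set g : M → ℝ → ℝ := fun j => chernoffSlope (N.phiUp j) (N.phiServer j) (N.phiDown j) γ with hg
  have hder : ∀ j, ∀ x < N.phiMin j, HasDerivAt (η j) (η j x * g j x) x := fun j x hx =>
    hasDerivAt_chernoff (hTu j) (hTs j) (hTd j) (hN j).2.1 (hN j).2.2.1 (hN j).2.2.2
      (hprod j) γ hx
  have hmono : ∀ j, StrictMonoOn (g j) (Set.Iio (N.phiMin j)) := fun j =>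
    strictMonoOn_chernoffSlope _ _ _ γ
  have hpos : ∀ j, ∀ x < N.phiMin j, 0 < η j x := fun j x hx =>
    mul_pos (integral_exp_pos ((hint j x).2 hx)) (Real.exp_pos _)
  have hη0 : ∀ j, η j 0 = 1 := fun j => by simp [hη, chernoff]
  have hmin0 : ∀ j, 0 < N.phiMin j := fun j =>
    lt_min (hN j).2.1 (lt_min (hN j).2.2.1 (hN j).2.2.2)
  have hderiv_iff : ∀ j, ∀ x < N.phiMin j, HasDerivAt (η j) 0 x ↔ g j x = 0 := by
    intro j x hx
    constructor
    · intro h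
      exact (mul_eq_zero.1 ((hder j x hx).unique h)).resolve_left (hpos j x hx).ne'
    · intro h
      simpa [h] using hder j x hx
  have hIio : ∀ j, ∀ x < N.phiMin j, g j x = 0 → IsMinOn (η j) (Set.Iio (N.phiMin j)) x :=
    fun j x hx h0 => isMinOn_Iio_of_log_deriv_eq_zero hx (hder j) (hpos j) (hmono j) h0
  have hmin_iff : ∀ j, ∀ x ∈ Set.Ioo 0 (N.phiMin j),
      IsMinOn (η j) (Set.Ioo 0 (N.phiMin j)) x ↔ g j x = 0 := by
    intro j x hx
    constructor
    · intro h
      have := (h.isLocalMin (Ioo_mem_nhds hx.1 hx.2)).hasDerivAt_eq_zero (hder j x hx.2)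
      exact (mul_eq_zero.1 this).resolve_left (hpos j x hx.2).ne'
    · exact fun h => (hIio j x hx.2 h).on_subset Set.Ioo_subset_Iio_self
  refine ⟨hint, fun j x hx => (hmin_iff j x hx).trans (hderiv_iff j x hx.2).symm, ?_, ?_, ?_⟩
  · rintro j x ⟨hx, hxm⟩ y ⟨hy, hym⟩
    exact (hmono j).injOn hx.2 hy.2
      (((hmin_iff j x hx).1 hxm).trans ((hmin_iff j y hy).1 hym).symm)
  · intro j
    constructor
    · rintro ⟨x, hx, hxm⟩
      have h := hmono j (hmin0 j) hx.2 hx.1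
      rw [(hmin_iff j x hx).1 hxm] at h
      simp only [hg, chernoffSlope, sub_zero] at h
      linarith
    · intro h
      obtain ⟨x, hx, hx0⟩ := exists_chernoffSlope_eq_zero (hN j).2.1 (hN j).2.2.1 (hN j).2.2.2 h
      exact ⟨x, hx, (hmin_iff j x hx).2 hx0⟩
  · intro xs hxs
    have hle : ∀ j, ∀ y < N.phiMin j, η j (xs j) ≤ η j y := fun j y hy =>
      hIio j (xs j) (hxs j).1.2 ((hmin_iff j _ (hxs j).1).1 (hxs j).2) hy
    have hle1 : ∀ j, η j (xs j) ≤ 1 := fun j => (hη0 j) ▸ hle j 0 (hmin0 j)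
    refine ⟨?_, ⟨xs, fun j => ⟨⟨(hxs j).1.1.le, (hxs j).1.2⟩, hle1 j⟩, rfl⟩, ?_⟩
    · refine sub_le_sub_left (Finset.prod_le_prod (fun j _ => ?_) fun j _ => ?_) 1
      · exact sub_nonneg.2 (hle1 j)
      · exact sub_le_sub_left
          (measureReal_ge_le_chernoff (hxs j).1.1.le ((hint j _).2 (hxs j).1.2)) 1
    · rintro _ ⟨x, hx, rfl⟩
      refine sub_le_sub_left (Finset.prod_le_prod (fun j _ => ?_) fun j _ => ?_) 1
      · exact sub_nonneg.2 (hx j).2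
      · exact sub_le_sub_left (hle j _ (hx j).1.2) 1
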